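/- Let $\mathcal{A}$ be a complex unital Banach algebra. An element $a\in\mathcal{A}$ is called g-Drazin invertible if there is $b\in\mathcal{A}$ with $ab=ba$, $bab=b$ and $a(1-ab)$ quasinilpotent (i.e. of spectral radius $0$). Suppose $x_1,x_2,x_3\in\mathcal{A}$ satisfy $$x_1x_2+x_1x_3+x_2x_3=\alpha_1+\alpha_2(x_1+x_2+x_3)\quad\text{and}\quad x_1x_2x_3=\beta(x_1+x_2+x_3),$$ where $(\alpha_1,\alpha_2,\beta)\in\mathbb{C}^3\setminus\mathcal{M}$ with $$\mathcal{M}=\{(\alpha_1,\alpha_2,0):\alpha_1,\alpha_2\in\mathbb{C},\ \alpha_1\alpha_2\neq0\}\cup\{(\alpha_1,0,0):\alpha_1\in\mathbb{C}\setminus\{0\}\}.$$ Then, among the four elements $x_1,\ x_2,\ x_3,\ x_1+x_2+x_3$, the g-Drazin invertibility of any three implies the g-Drazin invertibility of the remaining one. -/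

import Mathlib

/-- An element of a complex algebra is quasinilpotent if its spectral radius is `0`. -/
def IsQuasinilpotent {A : Type*} [NormedRing A] [NormedAlgebra ℂ A] (a : A) : Prop :=
  spectralRadius ℂ a = 0

/-- `b` is a generalized Drazin (g-Drazin) inverse of `a`:
`ab = ba`, `bab = b`, and `a(1 - ab)` is quasinilpotent. -/
structure IsGDrazinInverse {A : Type*} [NormedRing A] [NormedAlgebra ℂ A] (a b : A) : Prop where
  comm : a * b = b * a
  outer : b * a * b = b
  quasinilpotent : IsQuasinilpotent (a * (1 - a * b))

/-- `a` is g-Drazin invertible if it has a g-Drazin inverse. -/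
def IsGDrazinInvertible {A : Type*} [NormedRing A] [NormedAlgebra ℂ A] (a : A) : Prop :=
  ∃ b : A, IsGDrazinInverse a b

open Filter Topology Finset

/-! Put s = x₁ + x₂ + x₃. The relations give (z - x₁)(z - x₂)(z - x₃) = k(z)(μ(z) - s) with k(z) =
z² - α₂z + β and μ(z) = (z³ + α₁z)/k(z). Outside 𝓜, after cancelling common powers of z, μ is
analytic at 0 with an isolated zero there, so it carries punctured neighbourhoods of 0 onto
punctured neighbourhoods of 0. By Koliha's criterion (`isGDrazinInvertible_iff`), g-Drazin
invertibility means that z - a is a unit for all small z ≠ 0, and units satisfy the required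
cancellation.

The hard half of the criterion needs the spectral idempotent at 0. It is the mean of (1 - zc)⁻¹ over
the unit circle; its Riemann sums at roots of unity are exactly (1 - c^N)⁻¹, so its properties
follow from algebra and limits. -/

theorem tendsto_riemannSum {E : Type*} [NormedAddCommGroup E] [NormedSpace ℝ E] [CompleteSpace E]
    {g : ℝ → E} (hg : Continuous g) {s : ℝ} (hs₀ : 0 ≤ s) (hs₁ : s ≤ 1) :
    Tendsto (fun N : ℕ => (N : ℝ)⁻¹ • ∑ k ∈ range N, g ((k + s) / N)) atTop
      (𝓝 (∫ t in (0 : ℝ)..1, g t)) := by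
  have huc := (isCompact_Icc (a := (0 : ℝ)) (b := 1)).uniformContinuousOn_of_continuous
    hg.continuousOn
  rw [Metric.uniformContinuousOn_iff] at huc
  rw [Metric.tendsto_atTop]
  intro ε hε
  obtain ⟨δ, hδ, h⟩ := huc (ε / 2) (by positivity)
  obtain ⟨M, hM⟩ := exists_nat_gt δ⁻¹
  refine ⟨M, fun N hN => ?_⟩
  have hδN : δ⁻¹ < N := hM.trans_le (by exact_mod_cast hN)
  have hN0 : (0 : ℝ) < N := (inv_pos.mpr hδ).trans hδN
  have hNδ : (N : ℝ)⁻¹ < δ := inv_lt_of_inv_lt₀ hδ hδN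
  have hint : ∀ a b : ℝ, IntervalIntegrable g MeasureTheory.volume a b :=
    fun a b => hg.intervalIntegrable a b
  have hsum := intervalIntegral.sum_integral_adjacent_intervals
    (f := g) (μ := MeasureTheory.volume) (a := fun k : ℕ => (k : ℝ) / N) (n := N)
    (fun k _ => hint _ _)
  have hend : ((N : ℕ) : ℝ) / N = 1 := div_self hN0.ne'
  simp only [Nat.cast_zero, zero_div, hend] at hsum
  rw [← hsum, smul_sum, dist_eq_norm, ← sum_sub_distrib]
  have hterm : ∀ k ∈ range N, ‖(N : ℝ)⁻¹ • g ((k + s) / N) -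
      ∫ t in ((k : ℝ) / N)..((k + 1 : ℕ) : ℝ) / N, g t‖ ≤ ε / 2 * (N : ℝ)⁻¹ := by
    intro k hk
    have hk' : (k : ℝ) + 1 ≤ N := by exact_mod_cast mem_range.mp hk
    have hk0 : (0 : ℝ) ≤ k := Nat.cast_nonneg k
    have hlen : ((k + 1 : ℕ) : ℝ) / N - (k : ℝ) / N = (N : ℝ)⁻¹ := by
      push_cast; field_simp; ring
    have hconst : (N : ℝ)⁻¹ • g ((k + s) / N) =
        ∫ _t in ((k : ℝ) / N)..((k + 1 : ℕ) : ℝ) / N, g ((k + s) / N) := by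
      rw [intervalIntegral.integral_const, hlen]
    rw [hconst, ← intervalIntegral.integral_sub (by simp) (hint _ _)]
    refine (intervalIntegral.norm_integral_le_of_norm_le_const (C := ε / 2) ?_).trans ?_
    · intro t ht
      rw [Set.uIoc_of_le (by gcongr; simp)] at ht
      obtain ⟨ht1, ht2⟩ := ht
      push_cast at ht2
      rw [div_lt_iff₀ hN0] at ht1
      rw [le_div_iff₀ hN0] at ht2
      rw [← dist_eq_norm]
      refine (h _ ⟨by positivity, ?_⟩ _ ⟨?_, ?_⟩ ?_).le
      · rw [div_le_one hN0]; linarith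
      · nlinarith
      · nlinarith
      · rw [Real.dist_eq]
        refine lt_of_le_of_lt ?_ hNδ
        have : (k + s) / N - t = (k + s - t * N) * (N : ℝ)⁻¹ := by field_simp
        rw [this, abs_mul, abs_of_pos (inv_pos.mpr hN0)]
        refine mul_le_of_le_one_left (by positivity) (abs_le.mpr ⟨?_, ?_⟩) <;> linarith
    · rw [hlen, abs_of_pos (inv_pos.mpr hN0)]
  calc _ ≤ ∑ k ∈ range N, ε / 2 * (N : ℝ)⁻¹ := norm_sum_le_of_le _ hterm
    _ = ε / 2 := by rw [sum_const, card_range, nsmul_eq_mul]; field_simp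
    _ < ε := by linarith

/-! ### Averages over roots of unity -/

theorem IsPrimitiveRoot.sum_pow_pow_eq_zero {R : Type*} [CommRing R] [IsDomain R] {N : ℕ} {ω : R}
    (hω : IsPrimitiveRoot ω N) {j : ℕ} (hj : j ≠ 0) (hjN : j < N) :
    ∑ k ∈ range N, (ω ^ k) ^ j = 0 := by
  have h1 : ω ^ j ≠ 1 := hω.pow_ne_one_of_pos_of_lt hj hjN
  have h2 : (ω ^ j - 1) * ∑ k ∈ range N, (ω ^ j) ^ k = 0 := by
    rw [mul_geom_sum, ← pow_mul, mul_comm, pow_mul, hω.pow_eq_one, one_pow, sub_self]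
  simpa only [pow_right_comm] using (mul_eq_zero.mp h2).resolve_left (sub_ne_zero.mpr h1)

section PartialFractions

variable {A : Type*} [Ring A] [Algebra ℂ A]

/-- The average of `(1 - ω ^ k c)⁻¹` over the `N`-th roots of unity. -/
noncomputable def rootsAverage (c : A) (ω : ℂ) (N : ℕ) : A :=
  (N : ℂ)⁻¹ • ∑ k ∈ range N, Ring.inverse (1 - ω ^ k • c)

theorem sum_sum_smul_pow {N : ℕ} (hN : N ≠ 0) {ω : ℂ} (hω : IsPrimitiveRoot ω N) (c : A) :
    ∑ k ∈ range N, ∑ j ∈ range N, (ω ^ k • c) ^ j = (N : ℂ) • (1 : A) := by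
  rw [sum_comm, sum_eq_single 0]
  · simp [Nat.cast_smul_eq_nsmul]
  · intro j hj hj0
    simp only [smul_pow]
    rw [← sum_smul, hω.sum_pow_pow_eq_zero hj0 (mem_range.mp hj), zero_smul]
  · simp [hN]

variable {N : ℕ} {ω : ℂ} {c : A}

/-- Since (ω^k c)^N = c^N, each 1 - ω^k c divides 1 - c^N with a geometric sum as quotient; summing
over k kills every power of c except the zeroth. -/
theorem one_sub_pow_mul_rootsAverage (hN : N ≠ 0) (hω : IsPrimitiveRoot ω N)
    (hc : ∀ k, IsUnit (1 - ω ^ k • c)) : (1 - c ^ N) * rootsAverage c ω N = 1 := by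
  have hterm : ∀ k, (1 - c ^ N) * Ring.inverse (1 - ω ^ k • c) =
      ∑ j ∈ range N, (ω ^ k • c) ^ j := fun k => by
    have : c ^ N = (ω ^ k • c) ^ N := by
      rw [smul_pow, pow_right_comm, hω.pow_eq_one, one_pow, one_smul]
    rw [this, ← geom_sum_mul_neg, mul_assoc, Ring.mul_inverse_cancel _ (hc k), mul_one]
  rw [rootsAverage, mul_smul_comm, mul_sum, sum_congr rfl fun k _ => hterm k,
    sum_sum_smul_pow hN hω, inv_smul_smul₀ (by exact_mod_cast hN)]

theorem rootsAverage_mul_one_sub_pow (hN : N ≠ 0) (hω : IsPrimitiveRoot ω N)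
    (hc : ∀ k, IsUnit (1 - ω ^ k • c)) : rootsAverage c ω N * (1 - c ^ N) = 1 := by
  have hterm : ∀ k, Ring.inverse (1 - ω ^ k • c) * (1 - c ^ N) =
      ∑ j ∈ range N, (ω ^ k • c) ^ j := fun k => by
    have : c ^ N = (ω ^ k • c) ^ N := by
      rw [smul_pow, pow_right_comm, hω.pow_eq_one, one_pow, one_smul]
    rw [this, ← mul_neg_geom_sum, ← mul_assoc, Ring.inverse_mul_cancel _ (hc k), one_mul]
  rw [rootsAverage, smul_mul_assoc, sum_mul, sum_congr rfl fun k _ => hterm k,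
    sum_sum_smul_pow hN hω, inv_smul_smul₀ (by exact_mod_cast hN)]

end PartialFractions

/-! ### The spectral idempotent -/

/-- The sequence `e` consists of Riemann sums with offset `s`, so the limit does not depend on `s`.
This independence is what later makes `p` idempotent. -/
theorem exists_tendsto_shifted_inverse {A : Type*} [NormedRing A] [NormedAlgebra ℂ A]
    [CompleteSpace A] {c : A} (hc : ∀ z : ℂ, ‖z‖ = 1 → IsUnit (1 - z • c)) :
    ∃ p : A, ∀ s : ℝ, 0 ≤ s → s ≤ 1 → ∃ e : ℕ → A, Tendsto e atTop (𝓝 p) ∧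
      ∀ N ≠ 0, (1 - Complex.exp (2 * Real.pi * Complex.I * s) • c ^ N) * e N = 1 ∧
        e N * (1 - Complex.exp (2 * Real.pi * Complex.I * s) • c ^ N) = 1 := by
  let _ : NormedSpace ℝ A := NormedSpace.restrictScalars ℝ ℂ A
  set g : ℝ → A := fun t => Ring.inverse (1 - Complex.exp (2 * Real.pi * Complex.I * t) • c)
  have hnorm : ∀ t : ℝ, ‖Complex.exp (2 * Real.pi * Complex.I * t)‖ = 1 := fun t => by
    rw [show (2 * Real.pi * Complex.I * t : ℂ) = ((2 * Real.pi * t : ℝ) : ℂ) * Complex.I by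
      push_cast; ring, Complex.norm_exp_ofReal_mul_I]
  have hg : Continuous g := by
    rw [continuous_iff_continuousAt]
    intro t
    obtain ⟨u, hu⟩ := hc _ (hnorm t)
    refine ContinuousAt.comp (g := Ring.inverse)
      (f := fun t : ℝ => 1 - Complex.exp (2 * Real.pi * Complex.I * t) • c) ?_ ?_
    · rw [← hu]; exact NormedRing.inverse_continuousAt u
    · fun_prop
  refine ⟨∫ t in (0 : ℝ)..1, g t, fun s hs₀ hs₁ => ?_⟩
  refine ⟨fun N => (N : ℝ)⁻¹ • ∑ k ∈ range N, g ((k + s) / N),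
    tendsto_riemannSum hg hs₀ hs₁, fun N hN => ?_⟩
  have hNC : (N : ℂ) ≠ 0 := by exact_mod_cast hN
  set ω := Complex.exp (2 * Real.pi * Complex.I / N)
  set ζ := Complex.exp (2 * Real.pi * Complex.I * (s / N : ℝ))
  have hω : IsPrimitiveRoot ω N := Complex.isPrimitiveRoot_exp N hN
  have hexp : ∀ k : ℕ, Complex.exp (2 * Real.pi * Complex.I * (((k + s) / N : ℝ) : ℂ)) =
      ω ^ k * ζ := fun k => by
    rw [← Complex.exp_nat_mul, ← Complex.exp_add]
    congr 1
    push_cast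
    field_simp
  have hsum : (N : ℝ)⁻¹ • ∑ k ∈ range N, g ((k + s) / N) = rootsAverage (ζ • c) ω N := by
    have : ((N : ℝ)⁻¹ : ℝ) • (∑ k ∈ range N, g ((k + s) / N)) =
      ((((N : ℝ)⁻¹ : ℝ) : ℂ)) • ∑ k ∈ range N, g ((k + s) / N) := rfl
    rw [this, rootsAverage]
    push_cast
    congr 1
    refine sum_congr rfl fun k _ => ?_
    simp only [g]
    rw [hexp, mul_smul]
  have hpow : Complex.exp (2 * Real.pi * Complex.I * s) • c ^ N = (ζ • c) ^ N := by
    rw [smul_pow, ← Complex.exp_nat_mul]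
    congr 2
    push_cast
    field_simp
  have hu : ∀ k, IsUnit (1 - ω ^ k • ζ • c) := fun k => by
    rw [smul_smul, ← hexp]
    exact hc _ (hnorm _)
  beta_reduce
  rw [hsum, hpow]
  exact ⟨one_sub_pow_mul_rootsAverage hN hω hu, rootsAverage_mul_one_sub_pow hN hω hu⟩

theorem exists_idempotent_of_circle {A : Type*} [NormedRing A] [NormedAlgebra ℂ A]
    [CompleteSpace A] {c : A} (hc : ∀ z : ℂ, ‖z‖ = 1 → IsUnit (1 - z • c)) :
    ∃ p b : A, p * p = p ∧ c * p = p * c ∧ c * b = b * c ∧ c * b = 1 - p ∧ b * (1 - p) = b ∧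
      Tendsto (fun N => (c * p) ^ N) atTop (𝓝 0) := by
  obtain ⟨p, hp⟩ := exists_tendsto_shifted_inverse hc
  obtain ⟨e, he, he'⟩ := hp 0 le_rfl zero_le_one
  obtain ⟨f, hf, hf'⟩ := hp (1 / 2) (by norm_num) (by norm_num)
  have hhalf : Complex.exp (2 * Real.pi * Complex.I * ((1 / 2 : ℝ) : ℂ)) = -1 := by
    rw [← Complex.exp_pi_mul_I]
    congr 1
    push_cast
    ring
  simp only [hhalf, neg_smul, one_smul, sub_neg_eq_add] at hf'
  simp only [Complex.ofReal_zero, mul_zero, Complex.exp_zero, one_smul] at he'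
  -- Offsets 0 and 1/2 invert 1 - c^N and 1 + c^N; the product of these inverses is e(2N), which
  -- also tends to p.
  have hpp : p * p = p := by
    have h1 : Tendsto (fun N => e (2 * N)) atTop (𝓝 p) :=
      he.comp (tendsto_id.const_mul_atTop' (by norm_num))
    refine tendsto_nhds_unique (hf.mul he) (h1.congr' ?_)
    filter_upwards [eventually_ne_atTop 0] with N hN
    have h2 : (1 - c ^ (2 * N)) * (f N * e N) = 1 := by
      rw [show (1 : A) - c ^ (2 * N) = (1 - c ^ N) * (1 + c ^ N) by
          rw [two_mul, pow_add]; noncomm_ring,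
        mul_assoc, ← mul_assoc (1 + c ^ N), (hf' N hN).1, one_mul, (he' N hN).1]
    exact left_inv_eq_right_inv (he' (2 * N) (by omega)).2 h2
  have hce : ∀ N ≠ 0, Commute c (e N) := fun N hN =>
    let u : Aˣ := ⟨1 - c ^ N, e N, (he' N hN).1, (he' N hN).2⟩
    have hcu : Commute c u := (Commute.one_right c).sub_right (Commute.pow_right rfl N)
    hcu.units_inv_right
  have hcp : Commute c p := by
    refine tendsto_nhds_unique (he.const_mul c) ((he.mul_const c).congr' ?_)
    filter_upwards [eventually_ne_atTop 0] with N hN using (hce N hN).symm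
  have hce' : ∀ N ≠ 0, c ^ N * e N = e N - 1 := fun N hN => by
    have := (he' N hN).1
    rw [sub_mul, one_mul] at this
    rw [← this]; abel
  have hlim : Tendsto (fun N => c ^ N * e N) atTop (𝓝 (p - 1)) := by
    refine (he.sub_const 1).congr' ?_
    filter_upwards [eventually_ne_atTop 0] with N hN using (hce' N hN).symm
  have hpow : Tendsto (fun N => (c * p) ^ N) atTop (𝓝 0) := by
    have hz : Tendsto (fun N => c ^ N * e N * p) atTop (𝓝 0) := by
      simpa [sub_mul, hpp] using hlim.mul_const p
    have hz2 : Tendsto (fun N => 2 * ‖c ^ N * e N * p‖) atTop (𝓝 0) := by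
      simpa using hz.norm.const_mul 2
    refine squeeze_zero_norm' ?_ hz2
    filter_upwards [eventually_ne_atTop 0,
      hz.norm.eventually_lt_const (u := 1 / 2) (by simp)] with N hN hsmall
    rw [hcp.mul_pow, IsIdempotentElem.pow_eq hpp hN]
    set z := c ^ N * e N * p
    -- Once ‖z‖ < 1/2, this identity bounds ‖c^N p‖ by 2‖z‖.
    have hzy : c ^ N * p = z - z * (c ^ N * p) := by
      have h3 : z * (1 - c ^ N) = c ^ N * p := by
        simp only [z]
        rw [mul_assoc, mul_assoc, show p * (1 - c ^ N) = (1 - c ^ N) * p from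
          ((Commute.one_right p).sub_right (hcp.symm.pow_right N)), ← mul_assoc (e N),
          (he' N hN).2, one_mul]
      have h4 : z * (c ^ N * p) = z * c ^ N := by
        rw [(hcp.pow_left N).eq, ← mul_assoc]
        simp only [z]
        rw [mul_assoc _ p p, hpp]
      rw [h4, ← h3, mul_sub, mul_one]
    have h5 : ‖c ^ N * p‖ ≤ ‖z‖ + ‖z‖ * ‖c ^ N * p‖ := by
      calc ‖c ^ N * p‖ = ‖z - z * (c ^ N * p)‖ := by rw [← hzy]
        _ ≤ ‖z‖ + ‖z * (c ^ N * p)‖ := norm_sub_le _ _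
        _ ≤ _ := by gcongr; exact norm_mul_le _ _
    nlinarith [norm_nonneg (c ^ N * p)]
  have hq : (1 - p) * (1 - p) = 1 - p := by
    rw [mul_sub, sub_mul, sub_mul, hpp]; noncomm_ring
  -- For large N, -c^(N+1) e(N+1) acts on the range of 1 - p as a unit w near 1. The exponent N + 1
  -- leaves a factor c to split off, which inverts c there.
  have hunit : Tendsto (fun N => 1 - p + c ^ (N + 1) * e (N + 1) * (1 - p)) atTop (𝓝 0) := by
    have := ((hlim.comp (tendsto_add_atTop_nat 1)).mul_const (1 - p)).const_add (1 - p)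
    rwa [show 1 - p + (p - 1) * (1 - p) = 0 by
      rw [show p - 1 = -(1 - p) by abel, neg_mul, hq, add_neg_cancel]] at this
  obtain ⟨N, hN⟩ := (hunit.norm.eventually_lt_const (u := 1) (by simp)).exists
  obtain ⟨w, hw⟩ := isUnit_one_sub_of_norm_lt_one hN
  have hcw : Commute c w := by
    rw [hw]
    have h1 := hce (N + 1) (by omega)
    have h2 : Commute c (1 - p) := (Commute.one_right c).sub_right hcp
    exact (Commute.one_right c).sub_right
      (h2.add_right (((Commute.pow_right rfl _).mul_right h1).mul_right h2))
  have hwq : (w : A) * (1 - p) = -(c ^ (N + 1) * e (N + 1) * (1 - p)) := by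
    rw [hw, sub_mul, add_mul, mul_assoc _ (1 - p) (1 - p), hq]; noncomm_ring
  have hcb : c * (-(↑w⁻¹ * (c ^ N * e (N + 1) * (1 - p)))) = 1 - p := by
    rw [mul_neg, ← mul_assoc, hcw.units_inv_right.eq, mul_assoc, ← mul_assoc c, ← mul_assoc c,
      ← pow_succ', ← mul_neg, ← hwq, ← mul_assoc, Units.inv_mul, one_mul]
  refine ⟨p, -(↑w⁻¹ * (c ^ N * e (N + 1) * (1 - p))), hpp, hcp, ?_, hcb, ?_, hpow⟩
  · have h2 : Commute c (1 - p) := (Commute.one_right c).sub_right hcp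
    exact (hcw.units_inv_right.mul_right
      (((Commute.pow_right rfl _).mul_right (hce _ (by omega))).mul_right h2)).neg_right
  · rw [neg_mul, mul_assoc, mul_assoc (c ^ N * e (N + 1)), hq]

/-! ### Koliha's criterion -/

section GDrazin

variable {A : Type*} [NormedRing A] [NormedAlgebra ℂ A]

theorem isUnit_of_isQuasinilpotent {a : A} (ha : IsQuasinilpotent a) {z : ℂ} (hz : z ≠ 0) :
    IsUnit (algebraMap ℂ A z - a) := by
  by_contra h
  have h1 : (‖z‖₊ : ENNReal) ≤ spectralRadius ℂ a :=
    le_iSup₂ (f := fun (k : ℂ) (_ : k ∈ spectrum ℂ a) => (‖k‖₊ : ENNReal)) z h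
  rw [show spectralRadius ℂ a = 0 from ha] at h1
  simp [hz] at h1

variable [CompleteSpace A]

/-- Splitting along the idempotent ab, the resolvent is (z - a(1 - ab))⁻¹(1 - ab) - (1 - zb)⁻¹b. -/
theorem IsGDrazinInvertible.eventually_isUnit {a : A} (ha : IsGDrazinInvertible a) :
    ∀ᶠ z : ℂ in 𝓝[≠] 0, IsUnit (algebraMap ℂ A z - a) := by
  obtain ⟨b, hab, hbab, hq⟩ := ha
  have hlim : Tendsto (fun z : ℂ => ‖z • b‖) (𝓝[≠] 0) (𝓝 0) := by
    have : Continuous fun z : ℂ => ‖z • b‖ := by fun_prop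
    simpa using (this.tendsto 0).mono_left nhdsWithin_le_nhds
  filter_upwards [hlim.eventually_lt_const one_pos, self_mem_nhdsWithin] with z hz hz0
  obtain ⟨v, hv⟩ := isUnit_one_sub_of_norm_lt_one hz
  obtain ⟨u, hu⟩ := isUnit_of_isQuasinilpotent hq hz0
  have hca : Commute a (a * b) := by
    change a * (a * b) = a * b * a
    rw [hab, ← mul_assoc, hab]
  have hzc : ∀ x : A, Commute x (algebraMap ℂ A z) := fun x => (Algebra.commutes z x).symm
  have hau : Commute (algebraMap ℂ A z - a) u := by
    have h1 : Commute a u := by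
      rw [hu]
      exact (hzc a).sub_right ((Commute.refl a).mul_right ((Commute.one_right a).sub_right hca))
    exact ((hzc _).symm).sub_left h1
  have hav : Commute (algebraMap ℂ A z - a) v := by
    have h1 : Commute a v := by
      rw [hv]
      exact (Commute.one_right a).sub_right ((show Commute a b from hab).smul_right z)
    exact ((hzc _).symm).sub_left h1
  have hpp : a * b * (a * b) = a * b := by
    rw [mul_assoc, ← mul_assoc b, hbab]
  have hpb : a * b * b = b := by rw [hab, hbab]
  have hq1 : (algebraMap ℂ A z - a) * (1 - a * b) = u * (1 - a * b) := by
    rw [hu, sub_mul, sub_mul, mul_assoc a, mul_sub (1 - a * b), sub_mul 1 (a * b) (a * b), hpp]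
    simp
  have hq2 : (algebraMap ℂ A z - a) * -b = v * (a * b) := by
    rw [hv, sub_mul, sub_mul, one_mul, smul_mul_assoc, ← mul_assoc, ← hab, hpb,
      ← Algebra.smul_def]
    simp only [smul_neg, mul_neg]
    abel
  have hp : Commute (algebraMap ℂ A z - a) (1 - a * b) :=
    (Commute.one_right _).sub_right ((hzc _).symm.sub_left hca)
  have hb : Commute (algebraMap ℂ A z - a) (-b) :=
    ((hzc _).symm.sub_left (show Commute a b from hab)).neg_right
  have hR : (algebraMap ℂ A z - a) * (↑u⁻¹ * (1 - a * b) + ↑v⁻¹ * -b) = 1 := by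
    rw [mul_add, ← mul_assoc, ← mul_assoc, hau.units_inv_right.eq, hav.units_inv_right.eq,
      mul_assoc, mul_assoc, hq1, hq2, ← mul_assoc, ← mul_assoc, Units.inv_mul, Units.inv_mul]
    simp
  have hcomm : Commute (algebraMap ℂ A z - a) (↑u⁻¹ * (1 - a * b) + ↑v⁻¹ * -b) :=
    (hau.units_inv_right.mul_right hp).add_right (hav.units_inv_right.mul_right hb)
  exact ⟨⟨_, _, hR, hcomm.symm.eq.trans hR⟩, rfl⟩

theorem isGDrazinInvertible_of_eventually_isUnit {a : A}
    (ha : ∀ᶠ z : ℂ in 𝓝[≠] 0, IsUnit (algebraMap ℂ A z - a)) : IsGDrazinInvertible a := by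
  rw [eventually_nhdsWithin_iff, Metric.eventually_nhds_iff] at ha
  obtain ⟨ε, hε, h⟩ := ha
  set r : ℂ := ((ε / 2 : ℝ) : ℂ)
  have hr : ‖r‖ = ε / 2 := by simp [r, abs_of_pos hε]
  have hr0 : r ≠ 0 := by rw [← norm_pos_iff, hr]; positivity
  have hc : ∀ z : ℂ, ‖z‖ = 1 → IsUnit (1 - z • r⁻¹ • a) := fun z hz => by
    have hz0 : z ≠ 0 := by rw [← norm_pos_iff, hz]; exact one_pos
    have h1 : IsUnit (algebraMap ℂ A (r / z) - a) :=
      h (by simp [hr, hz]; linarith) (div_ne_zero hr0 hz0)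
    have h2 := h1.smul (Units.mk0 (z * r⁻¹) (mul_ne_zero hz0 (inv_ne_zero hr0)))
    convert h2 using 1
    rw [Units.smul_mk0, smul_sub, mul_smul, mul_smul, Algebra.algebraMap_eq_smul_one, smul_smul,
      smul_smul]
    rw [smul_smul (z * r⁻¹), show z * r⁻¹ * (r / z) = 1 by field_simp, one_smul]
  obtain ⟨p, b, hpp, hcp, hcb, hcb', hbq, hlim⟩ := exists_idempotent_of_circle hc
  have hap : a * p = p * a := by
    simp only [smul_mul_assoc, mul_smul_comm] at hcp
    exact smul_right_injective A (inv_ne_zero hr0) hcp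
  have habq : a * (r⁻¹ • b) = 1 - p := by
    rw [mul_smul_comm, ← smul_mul_assoc, hcb']
  have hba : a * (r⁻¹ • b) = r⁻¹ • b * a := by
    rw [mul_smul_comm, ← smul_mul_assoc, hcb, mul_smul_comm, smul_mul_assoc]
  refine ⟨r⁻¹ • b, ?_, ?_, ?_⟩
  · exact hba
  · rw [mul_assoc, habq, smul_mul_assoc, hbq]
  · rw [habq, sub_sub_cancel]
    have hspec : ∀ z ∈ spectrum ℂ (a * p), z = 0 := by
      intro z hz
      by_contra hz0
      -- Inside the circle the resolvent of ap is p(z - a)⁻¹ + z⁻¹(1 - p); on or outside it, a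
      -- spectral value contradicts (r⁻¹ap)^N → 0.
      rcases lt_or_ge ‖z‖ ‖r‖ with hlt | hge
      · obtain ⟨u, hu⟩ : IsUnit (algebraMap ℂ A z - a) := h (by simp; linarith) hz0
        have hpu : Commute p u := by
          rw [hu]
          exact (Algebra.commute_algebraMap_right z p).sub_right hap.symm
        have hpu' := hpu.units_inv_right
        have h1 : (algebraMap ℂ A z - a * p) * p = u * p := by
          rw [hu, sub_mul, sub_mul, mul_assoc, hpp]
        have h2 : (algebraMap ℂ A z - a * p) * (1 - p) = z • (1 - p) := by
          rw [sub_mul, mul_assoc, mul_sub p, hpp, ← Algebra.smul_def]; simp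
        have h3 : p * (algebraMap ℂ A z - a * p) = p * u := by
          rw [hu, mul_sub, mul_sub, ← mul_assoc, ← hap, mul_assoc, hpp, hap]
        have h4 : (1 - p) * (algebraMap ℂ A z - a * p) = z • (1 - p) := by
          rw [mul_sub, hap, ← mul_assoc, sub_mul 1 p p, hpp, ← Algebra.commutes,
            ← Algebra.smul_def]; simp
        apply hz
        refine ⟨⟨algebraMap ℂ A z - a * p, p * ↑u⁻¹ + z⁻¹ • (1 - p), ?_, ?_⟩, rfl⟩
        · rw [mul_add, ← mul_assoc, h1, mul_smul_comm, h2, inv_smul_smul₀ hz0, ← hpu.eq,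
            mul_assoc, Units.mul_inv, mul_one, add_sub_cancel]
        · rw [add_mul, hpu'.eq, mul_assoc, h3, smul_mul_assoc, h4, inv_smul_smul₀ hz0, hpu.eq,
            ← mul_assoc, Units.inv_mul, one_mul, add_sub_cancel]
      · have hlim' : Tendsto (fun N => ‖(r⁻¹ • a * p) ^ N‖ * ‖(1 : A)‖) atTop (𝓝 0) := by
          simpa using hlim.norm.mul_const ‖(1 : A)‖
        obtain ⟨N, hN⟩ := (hlim'.eventually_lt_const one_pos).exists
        have h1 := spectrum.norm_le_norm_mul_of_mem (spectrum.pow_mem_pow _ N hz)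
        have h2 : a * p = r • (r⁻¹ • a * p) := by rw [smul_mul_assoc, smul_inv_smul₀ hr0]
        rw [h2, smul_pow, norm_smul, norm_pow, norm_pow, mul_assoc] at h1
        have h3 : ‖r‖ ^ N ≤ ‖z‖ ^ N := pow_le_pow_left₀ (norm_nonneg _) hge N
        have h4 : 0 < ‖r‖ ^ N := pow_pos (norm_pos_iff.mpr hr0) N
        nlinarith
    rw [IsQuasinilpotent, spectralRadius]
    simp only [ENNReal.iSup_eq_zero]
    intro z hz
    simp [hspec z hz]

/-- Koliha's characterisation: `a` is g-Drazin invertible iff `0` is not an accumulation point of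
its spectrum. -/
theorem isGDrazinInvertible_iff {a : A} :
    IsGDrazinInvertible a ↔ ∀ᶠ z : ℂ in 𝓝[≠] 0, IsUnit (algebraMap ℂ A z - a) :=
  ⟨IsGDrazinInvertible.eventually_isUnit, isGDrazinInvertible_of_eventually_isUnit⟩

end GDrazin

/-! ### Transfer along the factorization -/

/-- An analytic function that vanishes at `0` only to finite order maps punctured neighbourhoods
of `0` onto punctured neighbourhoods of `0`. -/
theorem map_punctured_nhds_eq {μ : ℂ → ℂ} (hμ : AnalyticAt ℂ μ 0) (hμ0 : μ 0 = 0)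
    (hne : ∀ᶠ z in 𝓝[≠] 0, μ z ≠ 0) : map μ (𝓝[≠] 0) = 𝓝[≠] 0 := by
  apply le_antisymm
  · exact tendsto_nhdsWithin_iff.mpr
      ⟨by simpa [hμ0] using hμ.continuousAt.tendsto.mono_left nhdsWithin_le_nhds, hne⟩
  · have hopen : 𝓝 (μ 0) ≤ map μ (𝓝 0) := by
      refine hμ.eventually_constant_or_nhds_le_map_nhds.resolve_left fun hconst => ?_
      obtain ⟨z, h1, h2⟩ := (hne.and (hconst.filter_mono nhdsWithin_le_nhds)).exists
      exact h1 (h2.trans hμ0)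
    intro s hs
    rw [Filter.mem_map, mem_nhdsWithin_iff_eventually] at hs
    rw [mem_nhdsWithin_iff_eventually]
    rw [hμ0] at hopen
    have himg := hopen (image_mem_map hs)
    filter_upwards [himg] with w hw hw0
    obtain ⟨z, hz, rfl⟩ := hw
    exact hz fun h => hw0 (by rw [show z = 0 from h, hμ0]; rfl)

theorem isUnit_two_of_three {M : Type*} [Monoid M] {x y z : M} (hx : IsUnit x) (hy : IsUnit y) :
    (IsUnit (x * y * z) ↔ IsUnit z) ∧ (IsUnit (x * z * y) ↔ IsUnit z) ∧
      (IsUnit (z * x * y) ↔ IsUnit z) := by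
  obtain ⟨u, rfl⟩ := hx
  obtain ⟨v, rfl⟩ := hy
  refine ⟨?_, ?_, ?_⟩
  · rw [← Units.val_mul, Units.isUnit_units_mul]
  · rw [Units.isUnit_mul_units, Units.isUnit_units_mul]
  · rw [Units.isUnit_mul_units, Units.isUnit_mul_units]

theorem gDrazin_of_factorization {A : Type*} [NormedRing A] [NormedAlgebra ℂ A]
    [CompleteSpace A] {x₁ x₂ x₃ s : A} {k μ : ℂ → ℂ} (hμ : AnalyticAt ℂ μ 0)
    (hμ0 : μ 0 = 0) (hne : ∀ᶠ z in 𝓝[≠] 0, μ z ≠ 0) (hk : ∀ᶠ z in 𝓝[≠] 0, k z ≠ 0)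
    (hfac : ∀ᶠ z in 𝓝[≠] 0, (algebraMap ℂ A z - x₁) * (algebraMap ℂ A z - x₂) *
      (algebraMap ℂ A z - x₃) = k z • (algebraMap ℂ A (μ z) - s)) :
    (IsGDrazinInvertible x₁ → IsGDrazinInvertible x₂ → IsGDrazinInvertible x₃ →
      IsGDrazinInvertible s) ∧
    (IsGDrazinInvertible x₁ → IsGDrazinInvertible x₂ → IsGDrazinInvertible s →
      IsGDrazinInvertible x₃) ∧
    (IsGDrazinInvertible x₁ → IsGDrazinInvertible x₃ → IsGDrazinInvertible s →
      IsGDrazinInvertible x₂) ∧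
    (IsGDrazinInvertible x₂ → IsGDrazinInvertible x₃ → IsGDrazinInvertible s →
      IsGDrazinInvertible x₁) := by
  have hs : IsGDrazinInvertible s ↔ ∀ᶠ z : ℂ in 𝓝[≠] 0, IsUnit ((algebraMap ℂ A z - x₁) *
      (algebraMap ℂ A z - x₂) * (algebraMap ℂ A z - x₃)) := by
    rw [isGDrazinInvertible_iff]
    conv_lhs => rw [← map_punctured_nhds_eq hμ hμ0 hne, eventually_map]
    refine eventually_congr ?_
    filter_upwards [hk, hfac] with z hz hf
    rw [hf, ← Units.smul_mk0 hz, isUnit_smul_iff]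
  simp only [hs, isGDrazinInvertible_iff]
  refine ⟨fun h1 h2 h3 => ?_, fun h1 h2 h3 => ?_, fun h1 h2 h3 => ?_, fun h1 h2 h3 => ?_⟩ <;>
    filter_upwards [h1, h2, h3] with z hz1 hz2 hz3
  · exact (hz1.mul hz2).mul hz3
  · exact (isUnit_two_of_three hz1 hz2).1.mp hz3
  · exact (isUnit_two_of_three hz1 hz2).2.1.mp hz3
  · exact (isUnit_two_of_three hz1 hz2).2.2.mp hz3

/-- The expansion keeps the factors in order, so its coefficients are the given expressions and no
commutation is needed. -/
theorem resolvent_product_eq {A : Type*} [Ring A] [Algebra ℂ A] {x₁ x₂ x₃ : A} {α₁ α₂ β : ℂ}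
    (h₁ : x₁ * x₂ + x₁ * x₃ + x₂ * x₃ = algebraMap ℂ A α₁ + α₂ • (x₁ + x₂ + x₃))
    (h₂ : x₁ * x₂ * x₃ = β • (x₁ + x₂ + x₃)) (z : ℂ) :
    (algebraMap ℂ A z - x₁) * (algebraMap ℂ A z - x₂) * (algebraMap ℂ A z - x₃) =
      algebraMap ℂ A (z ^ 3 + α₁ * z) - (z ^ 2 - α₂ * z + β) • (x₁ + x₂ + x₃) := by
  have hexpand : (algebraMap ℂ A z - x₁) * (algebraMap ℂ A z - x₂) * (algebraMap ℂ A z - x₃) =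
      algebraMap ℂ A (z ^ 3) - z ^ 2 • (x₁ + x₂ + x₃) +
        z • (x₁ * x₂ + x₁ * x₃ + x₂ * x₃) - x₁ * x₂ * x₃ := by
    simp only [Algebra.algebraMap_eq_smul_one, sub_mul, mul_sub, smul_mul_assoc, mul_smul_comm,
      one_mul, mul_one]
    module
  rw [hexpand, h₁, h₂]
  simp only [Algebra.algebraMap_eq_smul_one]
  module


theorem theorem2p4 {A : Type*} [NormedRing A] [NormedAlgebra ℂ A] [CompleteSpace A]
    (x₁ x₂ x₃ : A) (α₁ α₂ β : ℂ)
    (h₁ : x₁ * x₂ + x₁ * x₃ + x₂ * x₃ = algebraMap ℂ A α₁ + α₂ • (x₁ + x₂ + x₃))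
    (h₂ : x₁ * x₂ * x₃ = β • (x₁ + x₂ + x₃))
    (hM : (α₁, α₂, β) ∉
      ({t : ℂ × ℂ × ℂ | ∃ a b : ℂ, a * b ≠ 0 ∧ t = (a, b, 0)} ∪
        {t : ℂ × ℂ × ℂ | ∃ a : ℂ, a ≠ 0 ∧ t = (a, 0, 0)})) :
    (IsGDrazinInvertible x₁ → IsGDrazinInvertible x₂ → IsGDrazinInvertible x₃ →
      IsGDrazinInvertible (x₁ + x₂ + x₃)) ∧
    (IsGDrazinInvertible x₁ → IsGDrazinInvertible x₂ → IsGDrazinInvertible (x₁ + x₂ + x₃) →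
      IsGDrazinInvertible x₃) ∧
    (IsGDrazinInvertible x₁ → IsGDrazinInvertible x₃ → IsGDrazinInvertible (x₁ + x₂ + x₃) →
      IsGDrazinInvertible x₂) ∧
    (IsGDrazinInvertible x₂ → IsGDrazinInvertible x₃ → IsGDrazinInvertible (x₁ + x₂ + x₃) →
      IsGDrazinInvertible x₁) := by
  have hid : ∀ᶠ z : ℂ in 𝓝[≠] 0, z ≠ 0 := self_mem_nhdsWithin
  have hpunct : ∀ {f : ℂ → ℂ}, Continuous f → f 0 ≠ 0 → ∀ᶠ z in 𝓝[≠] 0, f z ≠ 0 :=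
    fun hf h0 => (hf.continuousAt.eventually_ne h0).filter_mono nhdsWithin_le_nhds
  have hprod := resolvent_product_eq h₁ h₂
  by_cases hβ : β = 0
  · subst hβ
    have hα₁ : α₁ = 0 := by
      by_contra h
      refine hM ?_
      by_cases h2 : α₂ = 0
      · exact Or.inr ⟨α₁, h, by rw [h2]⟩
      · exact Or.inl ⟨α₁, α₂, mul_ne_zero h h2, rfl⟩
    subst hα₁
    by_cases hα₂ : α₂ = 0
    · subst hα₂
      refine gDrazin_of_factorization (k := fun z => z ^ 2) (μ := fun z => z) analyticAt_id rfl hid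
        (hid.mono fun z hz => pow_ne_zero 2 hz) (Eventually.of_forall fun z => ?_)
      rw [hprod z]
      simp only [Algebra.algebraMap_eq_smul_one]
      module
    -- A common factor z is cancelled from z³/(z² - α₂z) so that μ is analytic at 0.
    · have hk : ∀ᶠ z : ℂ in 𝓝[≠] 0, z - α₂ ≠ 0 := hpunct (by fun_prop) (by simpa using hα₂)
      refine gDrazin_of_factorization (k := fun z => z * (z - α₂))
        (μ := fun z => z ^ 2 / (z - α₂)) ?_ (by simp) ?_ ?_ ?_
      · exact AnalyticAt.div (by fun_prop) (by fun_prop) (by simpa using hα₂)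
      · filter_upwards [hid, hk] with z h1 h2 using div_ne_zero (pow_ne_zero 2 h1) h2
      · filter_upwards [hid, hk] with z h1 h2 using mul_ne_zero h1 h2
      · filter_upwards [hk] with z hz
        rw [hprod z, smul_sub, Algebra.algebraMap_eq_smul_one, Algebra.algebraMap_eq_smul_one,
          smul_smul]
        congr 2 <;> field_simp <;> ring
  · have hk : ∀ᶠ z : ℂ in 𝓝[≠] 0, z ^ 2 - α₂ * z + β ≠ 0 :=
      hpunct (f := fun z => z ^ 2 - α₂ * z + β) (by fun_prop) (by simpa using hβ)
    -- The zero of μ at 0 has order 3 if α₁ = 0 and order 1 otherwise.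
    have hn : ∀ᶠ z : ℂ in 𝓝[≠] 0, z ^ 2 + α₁ ≠ 0 := by
      by_cases hα₁ : α₁ = 0
      · filter_upwards [hid] with z hz
        simpa [hα₁] using hz
      · exact hpunct (f := fun z => z ^ 2 + α₁) (by fun_prop) (by simpa using hα₁)
    refine gDrazin_of_factorization (k := fun z => z ^ 2 - α₂ * z + β)
      (μ := fun z => (z ^ 3 + α₁ * z) / (z ^ 2 - α₂ * z + β)) ?_ (by simp) ?_ hk ?_
    · exact AnalyticAt.div (by fun_prop) (by fun_prop) (by simpa using hβ)
    · filter_upwards [hid, hk, hn] with z h1 h2 h3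
      refine div_ne_zero ?_ h2
      rw [show z ^ 3 + α₁ * z = z * (z ^ 2 + α₁) by ring]
      exact mul_ne_zero h1 h3
    · filter_upwards [hk] with z hz
      rw [hprod z, smul_sub, Algebra.algebraMap_eq_smul_one, Algebra.algebraMap_eq_smul_one,
        smul_smul, mul_div_cancel₀ _ hz]
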